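/- Let $I\subset\mathbb R$ be an open interval and let $C:(x(s),0,z(s))$, $s\in I$, be a smooth unit speed curve in the $xz$-plane with $x(s)>0$. Let $\theta:I\to\mathbb R$ be a smooth function with $x'=\cos\theta$ and $z'=\sin\theta$. Let $M$ be the surface of revolution parametrized by $$X(s,t)=(x(s)\cos t,\;x(s)\sin t,\;z(s)),\qquad s\in I,\ t\in\mathbb R,$$ with Gauss map $G=(X_s\times X_t)/|X_s\times X_t|$ and shape operator $S=-dG$. The Cheng–Yau operator of $M$ is $$\square f=-\operatorname{tr}(P_1\circ\nabla^2 f),\qquad P_1=\operatorname{tr}(S)\,\mathrm{Id}-S,$$ where $\nabla^2 f$ is the self-adjoint operator on tangent vectors that is metrically equivalent to the Hessian of $f$ for the induced metric; it is applied to $G$ componentwise. Suppose that the set $\{s\in I:\theta'(s)\neq 0\}$ is nonempty and that $\square G=AG$ on $M$ for some real $3\times 3$ matrix $A$. Then $A=\lambda I_3$ for some $\lambda\in\mathbb R$, where $I_3$ is the $3\times3$ identity matrix. -/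

import Mathlib

open scoped ContDiff Matrix

/-! Euclidean 3-space is `Fin 3 → ℝ` with the dot product `⬝ᵥ` as inner product.  A (parametrized,
immersed) surface is a map `X : ℝ × ℝ → (Fin 3 → ℝ)`, considered over an open set of parameters;
functions on the surface are functions of the parameters.  The operators below are the usual
expressions of the metric, the shape operator and the Hessian in the chart given by `X`. -/

namespace ParamSurface

noncomputable section

/-- The partial derivative with respect to the first (`i = 0`) or second (`i = 1`) parameter. -/
def pd {F : Type*} [NormedAddCommGroup F] [NormedSpace ℝ F] (i : Fin 2) (f : ℝ × ℝ → F)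
    (p : ℝ × ℝ) : F :=
  if i = 0 then deriv (fun u => f (u, p.2)) p.1 else deriv (fun v => f (p.1, v)) p.2

/-- The Gauss map: the unit normal `(X₁ × X₂) / |X₁ × X₂|`. -/
def gaussMap (X : ℝ × ℝ → Fin 3 → ℝ) (p : ℝ × ℝ) : Fin 3 → ℝ :=
  let n := pd 0 X p ⨯₃ pd 1 X p
  (Real.sqrt (n ⬝ᵥ n))⁻¹ • n

/-- The first fundamental form (induced metric) `g i j = ⟨Xᵢ, Xⱼ⟩`. -/
def metric (X : ℝ × ℝ → Fin 3 → ℝ) (p : ℝ × ℝ) : Matrix (Fin 2) (Fin 2) ℝ :=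
  Matrix.of fun i j => pd i X p ⬝ᵥ pd j X p

/-- The second fundamental form `h i j = ⟨S Xᵢ, Xⱼ⟩`, where the shape operator is `S = -dG`. -/
def secondForm (X : ℝ × ℝ → Fin 3 → ℝ) (p : ℝ × ℝ) : Matrix (Fin 2) (Fin 2) ℝ :=
  Matrix.of fun i j => -(pd i (gaussMap X) p ⬝ᵥ pd j X p)

/-- The matrix of the shape operator with respect to the Gauss map, in the basis `X₁, X₂`. -/
def shapeOperator (X : ℝ × ℝ → Fin 3 → ℝ) (p : ℝ × ℝ) : Matrix (Fin 2) (Fin 2) ℝ :=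
  (metric X p)⁻¹ * secondForm X p

/-- The Christoffel symbols `Γᵏᵢⱼ` of the induced metric. -/
def christoffel (X : ℝ × ℝ → Fin 3 → ℝ) (k i j : Fin 2) (p : ℝ × ℝ) : ℝ :=
  (1 / 2 : ℝ) * ∑ l : Fin 2, (metric X p)⁻¹ k l *
    (pd i (fun q => metric X q j l) p + pd j (fun q => metric X q i l) p
      - pd l (fun q => metric X q i j) p)

/-- The Hessian of `f` as a bilinear form: `∂ᵢ∂ⱼ f - ∑ₖ Γᵏᵢⱼ ∂ₖ f`. -/
def hessian (X : ℝ × ℝ → Fin 3 → ℝ) (f : ℝ × ℝ → ℝ) (p : ℝ × ℝ) : Matrix (Fin 2) (Fin 2) ℝ :=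
  Matrix.of fun i j => pd i (pd j f) p - ∑ k : Fin 2, christoffel X k i j p * pd k f p

/-- The matrix of `∇²f`, the operator on tangent vectors metrically equivalent to the Hessian. -/
def hessianOperator (X : ℝ × ℝ → Fin 3 → ℝ) (f : ℝ × ℝ → ℝ) (p : ℝ × ℝ) :
    Matrix (Fin 2) (Fin 2) ℝ :=
  (metric X p)⁻¹ * hessian X f p

/-- The operator `P₁ = tr(S) I - S`. -/
def newtonOperator (X : ℝ × ℝ → Fin 3 → ℝ) (p : ℝ × ℝ) : Matrix (Fin 2) (Fin 2) ℝ :=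
  (shapeOperator X p).trace • (1 : Matrix (Fin 2) (Fin 2) ℝ) - shapeOperator X p

/-- The Cheng-Yau operator `□f = -tr(P₁ ∘ ∇²f)`. -/
def chengYau (X : ℝ × ℝ → Fin 3 → ℝ) (f : ℝ × ℝ → ℝ) (p : ℝ × ℝ) : ℝ :=
  -(newtonOperator X p * hessianOperator X f p).trace

/-- `□G`, the Cheng-Yau operator applied to each component of the Gauss map. -/
def chengYauGauss (X : ℝ × ℝ → Fin 3 → ℝ) (p : ℝ × ℝ) : Fin 3 → ℝ :=
  fun c => chengYau X (fun q => gaussMap X q c) p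

/-- `s ↦ (x s, 0, z s)`, `s ∈ I`, is a smooth unit speed curve with `x > 0` on an open interval. -/
structure IsProfileCurve (I : Set ℝ) (x z : ℝ → ℝ) : Prop where
  isOpen : IsOpen I
  ordConnected : I.OrdConnected
  smooth_x : ContDiffOn ℝ ∞ x I
  smooth_z : ContDiffOn ℝ ∞ z I
  x_pos : ∀ s ∈ I, 0 < x s
  unit_speed : ∀ s ∈ I, deriv x s ^ 2 + deriv z s ^ 2 = 1

/-- `θ` is a smooth angle function of the profile curve: `x' = cos θ` and `z' = sin θ` on `I`. -/
structure IsProfileAngle (I : Set ℝ) (x z θ : ℝ → ℝ) : Prop where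
  smooth : ContDiffOn ℝ ∞ θ I
  deriv_x : ∀ s ∈ I, deriv x s = Real.cos (θ s)
  deriv_z : ∀ s ∈ I, deriv z s = Real.sin (θ s)

/-- The surface obtained by rotating the curve `(x, 0, z)` around the third axis. -/
def revolution (x z : ℝ → ℝ) (p : ℝ × ℝ) : Fin 3 → ℝ :=
  ![x p.1 * Real.cos p.2, x p.1 * Real.sin p.2, z p.1]

end

end ParamSurface

/-! Only the principal curvatures `a = θ'` and `b = sin θ / x` matter. The normal and meridian
components of `□G` are `ab(a + b)` and `(ab)'`. Comparing coefficients of `1, cos t, sin t` in `□G =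
AG` along a parallel with `sin θ, cos θ ≠ 0` forces `A = diag(α, α, μ)`, and the rest of the
equation reads `ab(a + b) = μ cos² θ + α sin² θ` and `(ab)' = (μ - α) sin θ cos θ`. With Codazzi
this system is overdetermined. If `α ≠ μ`, differentiating the first equation and eliminating
derivatives and `θ` gives an algebraic relation in `a, b, μ`. Differentiating that and eliminating
`μ` gives a homogeneous quadratic in `a, b`; one more derivative fixes `b/a` at a value that is not
a root of the quadratic (`eq_of_principal_curvatures`). The divisions need an open set where `θ'`,
`sin θ`, `cos θ` are nonzero (`exists_open_generic`). -/

namespace ParamSurface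

section PartialDerivatives

variable {F : Type*} [NormedAddCommGroup F] [NormedSpace ℝ F]

/-- Closed formulas hold only over `I × ℝ`; openness of `I` lets them be differentiated there. -/
theorem pd_congr {I : Set ℝ} (hI : IsOpen I) {f g : ℝ × ℝ → F}
    (h : ∀ s ∈ I, ∀ t, f (s, t) = g (s, t)) (i : Fin 2) {s : ℝ} (hs : s ∈ I) (t : ℝ) :
    pd i f (s, t) = pd i g (s, t) := by
  unfold pd
  split_ifs
  · apply Filter.EventuallyEq.deriv_eq
    filter_upwards [hI.mem_nhds hs] with u hu using h u hu t
  · exact congrArg (fun k => deriv k t) (funext fun v => h s hs v)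

theorem pd_zero_eq {f : ℝ × ℝ → F} {g : ℝ → F} {s t : ℝ} {d : F}
    (h : HasDerivAt g d s) (hfg : ∀ u, f (u, t) = g u) : pd 0 f (s, t) = d := by
  simpa [pd, hfg] using h.deriv

theorem pd_one_eq {f : ℝ × ℝ → F} {g : ℝ → F} {s t : ℝ} {d : F}
    (h : HasDerivAt g d t) (hfg : ∀ v, f (s, v) = g v) : pd 1 f (s, t) = d := by
  simpa [pd, hfg] using h.deriv

end PartialDerivatives

/-! ### Metric, Gauss map and shape operator of a surface of revolution. -/

theorem hasDerivAt_vec3 {f g h : ℝ → ℝ} {f' g' h' s : ℝ} (hf : HasDerivAt f f' s)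
    (hg : HasDerivAt g g' s) (hh : HasDerivAt h h' s) :
    HasDerivAt (fun u => ![f u, g u, h u]) ![f', g', h'] s := by
  rw [hasDerivAt_pi]
  intro i
  fin_cases i
  · exact hf
  · exact hg
  · exact hh

variable {I : Set ℝ} {x z θ : ℝ → ℝ}

theorem hasDerivAt_x (hC : IsProfileCurve I x z) (hθ : IsProfileAngle I x z θ) {s : ℝ}
    (hs : s ∈ I) : HasDerivAt x (Real.cos (θ s)) s := by
  rw [← hθ.deriv_x s hs]
  exact ((hC.smooth_x.contDiffAt (hC.isOpen.mem_nhds hs)).differentiableAt (by simp)).hasDerivAt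

theorem hasDerivAt_z (hC : IsProfileCurve I x z) (hθ : IsProfileAngle I x z θ) {s : ℝ}
    (hs : s ∈ I) : HasDerivAt z (Real.sin (θ s)) s := by
  rw [← hθ.deriv_z s hs]
  exact ((hC.smooth_z.contDiffAt (hC.isOpen.mem_nhds hs)).differentiableAt (by simp)).hasDerivAt

theorem hasDerivAt_angle (hC : IsProfileCurve I x z) (hθ : IsProfileAngle I x z θ) {s : ℝ}
    (hs : s ∈ I) : HasDerivAt θ (deriv θ s) s :=
  ((hθ.smooth.contDiffAt (hC.isOpen.mem_nhds hs)).differentiableAt (by simp)).hasDerivAt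

theorem hasDerivAt_deriv_angle (hC : IsProfileCurve I x z) (hθ : IsProfileAngle I x z θ) {s : ℝ}
    (hs : s ∈ I) : HasDerivAt (deriv θ) (deriv (deriv θ) s) s := by
  have h : ContDiffOn ℝ ∞ (deriv θ) I :=
    ((contDiffOn_infty_iff_deriv_of_isOpen hC.isOpen).1 hθ.smooth).2
  exact ((h.contDiffAt (hC.isOpen.mem_nhds hs)).differentiableAt (by simp)).hasDerivAt

theorem pd_zero_revolution (hC : IsProfileCurve I x z) (hθ : IsProfileAngle I x z θ) {s : ℝ}
    (hs : s ∈ I) (t : ℝ) : pd 0 (revolution x z) (s, t) =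
      ![Real.cos (θ s) * Real.cos t, Real.cos (θ s) * Real.sin t, Real.sin (θ s)] :=
  pd_zero_eq (hasDerivAt_vec3 ((hasDerivAt_x hC hθ hs).mul_const _)
    ((hasDerivAt_x hC hθ hs).mul_const _) (hasDerivAt_z hC hθ hs)) fun _ => rfl

theorem pd_one_revolution (x z : ℝ → ℝ) (s t : ℝ) : pd 1 (revolution x z) (s, t) =
      ![x s * -Real.sin t, x s * Real.cos t, 0] :=
  pd_one_eq (hasDerivAt_vec3 ((Real.hasDerivAt_cos t).const_mul _)
    ((Real.hasDerivAt_sin t).const_mul _) (hasDerivAt_const t (z s))) fun _ => rfl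

theorem gaussMap_revolution (hC : IsProfileCurve I x z) (hθ : IsProfileAngle I x z θ) {s : ℝ}
    (hs : s ∈ I) (t : ℝ) : gaussMap (revolution x z) (s, t) =
      ![-Real.sin (θ s) * Real.cos t, -Real.sin (θ s) * Real.sin t, Real.cos (θ s)] := by
  have hx := hC.x_pos s hs
  have hn : pd 0 (revolution x z) (s, t) ⨯₃ pd 1 (revolution x z) (s, t) = x s •
      ![-Real.sin (θ s) * Real.cos t, -Real.sin (θ s) * Real.sin t, Real.cos (θ s)] := by
    rw [pd_zero_revolution hC hθ hs, pd_one_revolution, cross_apply]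
    have h1 := Real.sin_sq_add_cos_sq t
    ext i
    fin_cases i <;> simp
    · ring
    · ring
    · linear_combination x s * Real.cos (θ s) * h1
  have hd : (x s • ![-Real.sin (θ s) * Real.cos t, -Real.sin (θ s) * Real.sin t, Real.cos (θ s)])
      ⬝ᵥ (x s • ![-Real.sin (θ s) * Real.cos t, -Real.sin (θ s) * Real.sin t, Real.cos (θ s)])
      = x s ^ 2 := by
    have h1 := Real.sin_sq_add_cos_sq t
    have h2 := Real.sin_sq_add_cos_sq (θ s)
    simp [dotProduct, Fin.sum_univ_three]
    linear_combination x s ^ 2 * Real.sin (θ s) ^ 2 * h1 + x s ^ 2 * h2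
  simp only [gaussMap]
  rw [hn, hd, Real.sqrt_sq hx.le, smul_smul, inv_mul_cancel₀ hx.ne', one_smul]

theorem metric_revolution (hC : IsProfileCurve I x z) (hθ : IsProfileAngle I x z θ) {s : ℝ}
    (hs : s ∈ I) (t : ℝ) : metric (revolution x z) (s, t) = !![1, 0; 0, x s ^ 2] := by
  have h1 := Real.sin_sq_add_cos_sq t
  have h2 := Real.sin_sq_add_cos_sq (θ s)
  ext i j
  fin_cases i <;> fin_cases j <;>
    simp [metric, pd_zero_revolution hC hθ hs, pd_one_revolution, dotProduct, Fin.sum_univ_three]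
  · linear_combination Real.cos (θ s) ^ 2 * h1 + h2
  · ring
  · ring
  · linear_combination x s ^ 2 * h1

theorem inv_metric_revolution (hC : IsProfileCurve I x z) (hθ : IsProfileAngle I x z θ) {s : ℝ}
    (hs : s ∈ I) (t : ℝ) :
    (metric (revolution x z) (s, t))⁻¹ = !![1, 0; 0, (x s ^ 2)⁻¹] := by
  have hx := (hC.x_pos s hs).ne'
  rw [metric_revolution hC hθ hs]
  apply Matrix.inv_eq_right_inv
  ext i j
  fin_cases i <;> fin_cases j <;> simp [Matrix.mul_apply, Fin.sum_univ_two, hx]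

theorem pd_zero_gaussMap (hC : IsProfileCurve I x z) (hθ : IsProfileAngle I x z θ) {s : ℝ}
    (hs : s ∈ I) (t : ℝ) : pd 0 (gaussMap (revolution x z)) (s, t) =
      ![-(Real.cos (θ s) * deriv θ s) * Real.cos t, -(Real.cos (θ s) * deriv θ s) * Real.sin t,
        -Real.sin (θ s) * deriv θ s] := by
  rw [pd_congr (g := fun p => ![-Real.sin (θ p.1) * Real.cos p.2,
    -Real.sin (θ p.1) * Real.sin p.2, Real.cos (θ p.1)]) hC.isOpen
    (fun s hs t => gaussMap_revolution hC hθ hs t) 0 hs t]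
  have h := hasDerivAt_angle hC hθ hs
  exact pd_zero_eq (hasDerivAt_vec3 (h.sin.neg.mul_const _) (h.sin.neg.mul_const _) h.cos) fun _ => rfl

theorem pd_one_gaussMap (hC : IsProfileCurve I x z) (hθ : IsProfileAngle I x z θ) {s : ℝ}
    (hs : s ∈ I) (t : ℝ) : pd 1 (gaussMap (revolution x z)) (s, t) =
      ![-Real.sin (θ s) * -Real.sin t, -Real.sin (θ s) * Real.cos t, 0] := by
  rw [pd_congr (g := fun p => ![-Real.sin (θ p.1) * Real.cos p.2,
    -Real.sin (θ p.1) * Real.sin p.2, Real.cos (θ p.1)]) hC.isOpen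
    (fun s hs t => gaussMap_revolution hC hθ hs t) 1 hs t]
  exact pd_one_eq (hasDerivAt_vec3 ((Real.hasDerivAt_cos t).const_mul _)
    ((Real.hasDerivAt_sin t).const_mul _) (hasDerivAt_const t (Real.cos (θ s)))) fun _ => rfl

theorem shapeOperator_revolution (hC : IsProfileCurve I x z) (hθ : IsProfileAngle I x z θ) {s : ℝ}
    (hs : s ∈ I) (t : ℝ) :
    shapeOperator (revolution x z) (s, t) = !![deriv θ s, 0; 0, Real.sin (θ s) / x s] := by
  have hx := (hC.x_pos s hs).ne'
  have h1 := Real.sin_sq_add_cos_sq t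
  have h2 := Real.sin_sq_add_cos_sq (θ s)
  rw [shapeOperator, inv_metric_revolution hC hθ hs]
  ext i j
  fin_cases i <;> fin_cases j <;>
    simp [Matrix.mul_apply, secondForm, pd_zero_revolution hC hθ hs, pd_one_revolution,
      pd_zero_gaussMap hC hθ hs, pd_one_gaussMap hC hθ hs, dotProduct, Fin.sum_univ_three,
      Fin.sum_univ_two]
  · linear_combination deriv θ s * Real.cos (θ s) ^ 2 * h1 + deriv θ s * h2
  · ring
  · right; ring
  · field_simp
    linear_combination Real.sin (θ s) * h1

theorem pd_zero_metric (hC : IsProfileCurve I x z) (hθ : IsProfileAngle I x z θ) {s : ℝ}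
    (hs : s ∈ I) (t : ℝ) (i j : Fin 2) : pd 0 (fun q => metric (revolution x z) q i j) (s, t) =
      !![0, 0; 0, 2 * x s * Real.cos (θ s)] i j := by
  rw [pd_congr (g := fun p => !![1, 0; 0, x p.1 ^ 2] i j) hC.isOpen
    (fun s hs t => by rw [metric_revolution hC hθ hs]) 0 hs t]
  have h := (hasDerivAt_x hC hθ hs).pow 2
  fin_cases i <;> fin_cases j
  · exact pd_zero_eq (hasDerivAt_const _ _) fun _ => rfl
  · exact pd_zero_eq (hasDerivAt_const _ _) fun _ => rfl
  · exact pd_zero_eq (hasDerivAt_const _ _) fun _ => rfl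
  · exact (pd_zero_eq h fun _ => rfl).trans (by simp)

theorem pd_one_metric (hC : IsProfileCurve I x z) (hθ : IsProfileAngle I x z θ) {s : ℝ}
    (hs : s ∈ I) (t : ℝ) (i j : Fin 2) :
    pd 1 (fun q => metric (revolution x z) q i j) (s, t) = 0 := by
  rw [pd_congr (g := fun p => !![1, 0; 0, x p.1 ^ 2] i j) hC.isOpen
    (fun s hs t => by rw [metric_revolution hC hθ hs]) 1 hs t]
  exact pd_one_eq (hasDerivAt_const _ (!![1, 0; 0, x s ^ 2] i j)) fun _ => rfl

/-! ### The Cheng–Yau operator of a surface of revolution. -/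

theorem chengYau_revolution (hC : IsProfileCurve I x z) (hθ : IsProfileAngle I x z θ) {s : ℝ}
    (hs : s ∈ I) (t : ℝ) (f : ℝ × ℝ → ℝ) : chengYau (revolution x z) f (s, t) =
      -(Real.sin (θ s) / x s * pd 0 (pd 0 f) (s, t) + deriv θ s *
        ((pd 1 (pd 1 f) (s, t) + x s * Real.cos (θ s) * pd 0 f (s, t)) / x s ^ 2)) := by
  have hx := (hC.x_pos s hs).ne'
  -- `P₁` is diagonal with the principal curvatures swapped, so only the diagonal of the Hessian
  -- enters.
  have hdiag : ∀ a b : ℝ, ∀ H : Matrix (Fin 2) (Fin 2) ℝ,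
      ((!![a, 0; 0, b].trace • (1 : Matrix (Fin 2) (Fin 2) ℝ) - !![a, 0; 0, b]) *
        (!![1, 0; 0, (x s ^ 2)⁻¹] * H)).trace = b * H 0 0 + a * ((x s ^ 2)⁻¹ * H 1 1) := by
    intro a b H
    simp [Matrix.trace, Matrix.mul_apply, Fin.sum_univ_two, Matrix.vecMul, dotProduct]
  rw [chengYau, newtonOperator, hessianOperator, shapeOperator_revolution hC hθ hs,
    inv_metric_revolution hC hθ hs, hdiag]
  -- On the diagonal the only nonzero Christoffel symbol is `Γ⁰₁₁ = -x cos θ`.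
  simp [hessian, christoffel, inv_metric_revolution hC hθ hs, Fin.sum_univ_two, pd_zero_metric hC hθ hs, pd_one_metric hC hθ hs]
  field_simp
  simp

/-- Explicit form of `□G` for a surface of revolution. -/
theorem chengYauGauss_revolution (hC : IsProfileCurve I x z) (hθ : IsProfileAngle I x z θ) {s : ℝ}
    (hs : s ∈ I) (t : ℝ) : chengYauGauss (revolution x z) (s, t) =
      let Φ := Real.sin (θ s) / x s *
          (deriv (deriv θ) s * Real.cos (θ s) - deriv θ s ^ 2 * Real.sin (θ s))
          - deriv θ s * Real.sin (θ s) / x s ^ 2 + deriv θ s ^ 2 * Real.cos (θ s) ^ 2 / x s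
      ![Φ * Real.cos t, Φ * Real.sin t, Real.sin (θ s) / x s *
          (deriv (deriv θ) s * Real.sin (θ s) + 2 * deriv θ s ^ 2 * Real.cos (θ s))] := by
  have hx := (hC.x_pos s hs).ne'
  -- the operator on a product `p s * q t`
  have key : ∀ (f : ℝ × ℝ → ℝ) (p p' q q' : ℝ → ℝ) (p'' q'' : ℝ),
      (∀ s ∈ I, ∀ t, f (s, t) = p s * q t) → (∀ s ∈ I, HasDerivAt p (p' s) s) →
      HasDerivAt p' p'' s → (∀ t, HasDerivAt q (q' t) t) → HasDerivAt q' q'' t →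
      chengYau (revolution x z) f (s, t) = -(Real.sin (θ s) / x s * (p'' * q t) + deriv θ s *
        ((p s * q'' + x s * Real.cos (θ s) * (p' s * q t)) / x s ^ 2)) := by
    intro f p p' q q' p'' q'' hf hp hp' hq hq'
    have h0 : ∀ s ∈ I, ∀ t, pd 0 f (s, t) = p' s * q t := fun s hs t => by
      rw [pd_congr (g := fun y => p y.1 * q y.2) hC.isOpen hf 0 hs t]
      exact pd_zero_eq ((hp s hs).mul_const _) fun _ => rfl
    have h1 : ∀ s ∈ I, ∀ t, pd 1 f (s, t) = p s * q' t := fun s hs t => by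
      rw [pd_congr (g := fun y => p y.1 * q y.2) hC.isOpen hf 1 hs t]
      exact pd_one_eq ((hq t).const_mul _) fun _ => rfl
    rw [chengYau_revolution hC hθ hs, h0 s hs,
      pd_congr (g := fun y => p' y.1 * q y.2) hC.isOpen h0 0 hs t,
      pd_congr (g := fun y => p y.1 * q' y.2) hC.isOpen h1 1 hs t,
      pd_zero_eq (hp'.mul_const (q t)) fun _ => rfl, pd_one_eq (hq'.const_mul (p s)) fun _ => rfl]
  have hθ1 : ∀ s ∈ I, HasDerivAt θ (deriv θ s) s := fun s hs => hasDerivAt_angle hC hθ hs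
  have hθ2 := hasDerivAt_deriv_angle hC hθ hs
  have hsin : ∀ s ∈ I, HasDerivAt (fun u => -Real.sin (θ u)) (-(Real.cos (θ s) * deriv θ s)) s :=
    fun s hs => (hθ1 s hs).sin.neg
  have hcos : ∀ s ∈ I, HasDerivAt (fun u => Real.cos (θ u)) (-Real.sin (θ s) * deriv θ s) s :=
    fun s hs => (hθ1 s hs).cos
  ext c
  fin_cases c
  · refine (key _ _ _ _ _ _ _ (fun s hs t => by rw [gaussMap_revolution hC hθ hs]; rfl)
      hsin ((hcos s hs).mul hθ2).neg Real.hasDerivAt_cos (Real.hasDerivAt_sin t).neg).trans ?_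
    simp
    field_simp
    ring
  · refine (key _ _ _ _ _ _ _ (fun s hs t => by rw [gaussMap_revolution hC hθ hs]; rfl)
      hsin ((hcos s hs).mul hθ2).neg Real.hasDerivAt_sin (Real.hasDerivAt_cos t)).trans ?_
    simp
    field_simp
    ring
  · refine (key _ _ _ (fun _ => 1) (fun _ => 0) _ _
      (fun s hs t => by rw [gaussMap_revolution hC hθ hs, mul_one]; rfl)
      hcos ((hsin s hs).mul hθ2) (fun t => hasDerivAt_const t _) (hasDerivAt_const t _)).trans ?_
    simp
    field_simp
    ring

end ParamSurface

/-! ### The overdetermined system for the principal curvatures. -/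

theorem HasDerivAt.unique_of_eqOn {J : Set ℝ} (hJ : IsOpen J) {f g : ℝ → ℝ} {f' g' s : ℝ}
    (h : Set.EqOn f g J) (hs : s ∈ J) (hf : HasDerivAt f f' s) (hg : HasDerivAt g g' s) :
    f' = g' :=
  hf.unique (hg.congr_of_eventuallyEq (Filter.eventuallyEq_of_mem (hJ.mem_nhds hs) h))

/-- The principal curvatures `a = θ'` and `b = sin θ / x` of a surface of revolution satisfying
the Codazzi equation `sin θ b' = cos θ b (a - b)` cannot solve the two equations below unless
`α = μ`. -/
theorem eq_of_principal_curvatures {J : Set ℝ} (hJ : IsOpen J) (hne : J.Nonempty)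
    {a b a' b' θ : ℝ → ℝ} {α μ : ℝ}
    (hθ : ∀ s ∈ J, HasDerivAt θ (a s) s) (ha : ∀ s ∈ J, HasDerivAt a (a' s) s)
    (hb : ∀ s ∈ J, HasDerivAt b (b' s) s)
    (ha0 : ∀ s ∈ J, a s ≠ 0) (hb0 : ∀ s ∈ J, b s ≠ 0)
    (hsin : ∀ s ∈ J, Real.sin (θ s) ≠ 0) (hcos : ∀ s ∈ J, Real.cos (θ s) ≠ 0)
    (codazzi : ∀ s ∈ J, Real.sin (θ s) * b' s = Real.cos (θ s) * b s * (a s - b s))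
    (normal : ∀ s ∈ J, a s * b s * (a s + b s)
      = μ * Real.cos (θ s) ^ 2 + α * Real.sin (θ s) ^ 2)
    (tangential : ∀ s ∈ J, a' s * b s + a s * b' s
      = (μ - α) * Real.sin (θ s) * Real.cos (θ s)) : α = μ := by
  by_contra hαμ
  have hc : μ - α ≠ 0 := sub_ne_zero.2 (Ne.symm hαμ)
  have pyth : ∀ s, Real.sin (θ s) ^ 2 + Real.cos (θ s) ^ 2 = 1 := fun s =>
    Real.sin_sq_add_cos_sq _
  -- Derivative of `normal`, with `a'` and `b'` removed by `tangential` and `codazzi`.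
  have h3 : ∀ s ∈ J, (μ - α) * Real.sin (θ s) ^ 2 * (4 * a s + b s)
      = a s * b s * (a s - b s) ^ 2 := by
    intro s hs
    have e := HasDerivAt.unique_of_eqOn hJ normal hs
      (((ha s hs).mul (hb s hs)).mul ((ha s hs).add (hb s hs)))
      ((((hθ s hs).cos.pow 2).const_mul μ).add (((hθ s hs).sin.pow 2).const_mul α))
    simp only [Pi.mul_apply] at e
    apply mul_left_cancel₀ (hcos s hs)
    norm_num at e
    linear_combination Real.sin (θ s) * e + a s * (a s - b s) * codazzi s hs
      - Real.sin (θ s) * (2 * a s + b s) * tangential s hs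
  -- Since `normal` says `(μ - α) sin² θ = μ - ab(a + b)`, the angle drops out of `h3`.
  have h4 : ∀ s ∈ J, a s * b s * (5 * a s ^ 2 + 3 * a s * b s + 2 * b s ^ 2)
      = μ * (4 * a s + b s) := by
    intro s hs
    linear_combination (4 * a s + b s) * normal s hs - h3 s hs
      + μ * (4 * a s + b s) * pyth s
  have hbsa : ∀ s ∈ J, b s * Real.sin (θ s) * a' s
      = Real.cos (θ s) * (μ - 2 * a s ^ 2 * b s) := by
    intro s hs
    linear_combination Real.sin (θ s) * tangential s hs - a s * codazzi s hs
      + Real.cos (θ s) * normal s hs + Real.cos (θ s) * μ * pyth s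
  have hab : ∀ s ∈ J, a s - b s ≠ 0 := by
    intro s hs h
    have e := h3 s hs
    rw [← sub_eq_zero.1 h, sub_self] at e
    have : (μ - α) * Real.sin (θ s) ^ 2 * (5 * a s) = 0 := by linear_combination e
    simp [hc, hsin s hs, ha0 s hs] at this
  have h5 : ∀ s ∈ J, 8 * a s ^ 2 + 17 * (a s * b s) + 5 * b s ^ 2 = 0 := by
    intro s hs
    have e := HasDerivAt.unique_of_eqOn hJ h4 hs
      (((ha s hs).mul (hb s hs)).mul (((((ha s hs).pow 2).const_mul 5).add
        (((ha s hs).const_mul 3).mul (hb s hs))).add (((hb s hs).pow 2).const_mul 2)))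
      ((((ha s hs).const_mul 4).add (hb s hs)).const_mul μ)
    simp only [Pi.mul_apply] at e
    norm_num at e
    have H : (15 * a s ^ 2 * b s + 6 * a s * b s ^ 2 + 2 * b s ^ 3 - 4 * μ)
        * (μ - 2 * a s ^ 2 * b s)
        + (5 * a s ^ 3 + 6 * a s ^ 2 * b s + 6 * a s * b s ^ 2 - μ) * b s ^ 2 * (a s - b s) = 0 := by
      apply mul_left_cancel₀ (hcos s hs)
      linear_combination b s * Real.sin (θ s) * e
        - (15 * a s ^ 2 * b s + 6 * a s * b s ^ 2 + 2 * b s ^ 3 - 4 * μ) * hbsa s hs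
        - (5 * a s ^ 3 + 6 * a s ^ 2 * b s + 6 * a s * b s ^ 2 - μ) * b s * codazzi s hs
    have hne : a s ^ 2 * b s ^ 2 * (a s - b s) ^ 2 ≠ 0 :=
      mul_ne_zero (mul_ne_zero (pow_ne_zero _ (ha0 s hs)) (pow_ne_zero _ (hb0 s hs)))
        (pow_ne_zero _ (hab s hs))
    -- `H` is quadratic in `μ`; the factor `(4a + b)²` lets `h4` eliminate `μ`, without assuming `4a
    -- + b ≠ 0`. What remains is `-5a²b²(a - b)²` times the quadratic.
    apply mul_left_cancel₀ hne
    linear_combination -(1 / 5 : ℝ) * (4 * a s + b s) ^ 2 * H - (1 / 5 : ℝ) *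
      (-4 * (a s * b s * (5 * a s ^ 2 + 3 * a s * b s + 2 * b s ^ 2) + μ * (4 * a s + b s))
        + (15 * a s ^ 2 * b s + 6 * a s * b s ^ 2 + 2 * b s ^ 3 + 8 * a s ^ 2 * b s
          - b s ^ 2 * (a s - b s)) * (4 * a s + b s)) * h4 s hs
  obtain ⟨s, hs⟩ := hne
  have e := HasDerivAt.unique_of_eqOn hJ h5 hs
    (((((ha s hs).pow 2).const_mul 8).add (((ha s hs).mul (hb s hs)).const_mul 17)).add
      (((hb s hs).pow 2).const_mul 5)) (hasDerivAt_const s (0 : ℝ))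
  norm_num at e
  -- The same procedure applied to `h5`: differentiate, then eliminate `a'`, `b'`, and next `μ`.
  have K : (16 * a s + 17 * b s) * (μ - 2 * a s ^ 2 * b s)
      + (17 * a s + 10 * b s) * b s ^ 2 * (a s - b s) = 0 := by
    apply mul_left_cancel₀ (hcos s hs)
    linear_combination b s * Real.sin (θ s) * e - (16 * a s + 17 * b s) * hbsa s hs
      - (17 * a s + 10 * b s) * b s * codazzi s hs
  have W : 48 * a s ^ 3 + 15 * a s ^ 2 * b s - 23 * a s * b s ^ 2 - 10 * b s ^ 3 = 0 := by
    apply mul_left_cancel₀ (mul_ne_zero (hb0 s hs) (hab s hs))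
    linear_combination -(4 * a s + b s) * K - (16 * a s + 17 * b s) * h4 s hs
  have L : 152 * a s - 32 * b s = 0 := by
    apply mul_left_cancel₀ (pow_ne_zero 2 (ha0 s hs))
    -- Division of the cubic by the quadratic: the multiplier cancels the `b³` and `ab²` terms.
    linear_combination 5 * W + (10 * b s - 11 * a s) * h5 s hs
  have hba : b s = 19 / 4 * a s := by linear_combination -L / 32
  have h := h5 s hs
  rw [hba] at h
  have := ha0 s hs
  have : 0 < a s ^ 2 := by positivity
  -- At `b = 19a/4` the quadratic is a positive multiple of `a²`.
  nlinarith

/-! ### Shape of `A` and generic points of the profile. -/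

namespace ParamSurface

variable {I : Set ℝ} {x z θ : ℝ → ℝ}

/-- Comparing the coefficients of `1`, `cos t` and `sin t` in `□G = A G` along one parallel. -/
theorem coefficients_of_chengYauGauss_eq (hC : IsProfileCurve I x z)
    (hθ : IsProfileAngle I x z θ) {A : Matrix (Fin 3) (Fin 3) ℝ} {s : ℝ} (hs : s ∈ I)
    (hsin : Real.sin (θ s) ≠ 0) (hcos : Real.cos (θ s) ≠ 0)
    (hA : ∀ t : ℝ, chengYauGauss (revolution x z) (s, t)
      = A *ᵥ gaussMap (revolution x z) (s, t)) :
    A = !![A 0 0, 0, 0; 0, A 0 0, 0; 0, 0, A 2 2] ∧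
    Real.sin (θ s) / x s *
          (deriv (deriv θ) s * Real.cos (θ s) - deriv θ s ^ 2 * Real.sin (θ s))
          - deriv θ s * Real.sin (θ s) / x s ^ 2 + deriv θ s ^ 2 * Real.cos (θ s) ^ 2 / x s
      = -A 0 0 * Real.sin (θ s) ∧
    Real.sin (θ s) / x s *
          (deriv (deriv θ) s * Real.sin (θ s) + 2 * deriv θ s ^ 2 * Real.cos (θ s))
      = A 2 2 * Real.cos (θ s) := by
  -- Parameters `0` and `π` separate the constant term from the `cos t` term; `π / 2` then gives the
  -- `sin t` term.
  have h0 := hA 0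
  have h1 := hA Real.pi
  have h2 := hA (Real.pi / 2)
  rw [chengYauGauss_revolution hC hθ hs, gaussMap_revolution hC hθ hs] at h0 h1 h2
  generalize Real.sin (θ s) / x s *
          (deriv (deriv θ) s * Real.cos (θ s) - deriv θ s ^ 2 * Real.sin (θ s))
          - deriv θ s * Real.sin (θ s) / x s ^ 2 + deriv θ s ^ 2 * Real.cos (θ s) ^ 2 / x s
    = Φ at *
  generalize Real.sin (θ s) / x s *
          (deriv (deriv θ) s * Real.sin (θ s) + 2 * deriv θ s ^ 2 * Real.cos (θ s)) = Ψ at *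
  have e0 := fun i => congrFun h0 i
  have e1 := fun i => congrFun h1 i
  have e2 := fun i => congrFun h2 i
  simp [Fin.forall_fin_succ, Matrix.mulVec, dotProduct, Fin.sum_univ_three] at e0 e1 e2
  obtain ⟨e00, e01, e02⟩ := e0
  obtain ⟨e10, e11, e12⟩ := e1
  obtain ⟨e20, e21, e22⟩ := e2
  have a02 : A 0 2 = 0 := by
    apply mul_right_cancel₀ hcos
    linear_combination -(e00 + e10) / 2
  have a12 : A 1 2 = 0 := by
    apply mul_right_cancel₀ hcos
    linear_combination -(e01 + e11) / 2
  have a01 : A 0 1 = 0 := by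
    apply mul_right_cancel₀ hsin
    linear_combination e20 + Real.cos (θ s) * a02
  have a10 : A 1 0 = 0 := by
    apply mul_right_cancel₀ hsin
    linear_combination e01 + Real.cos (θ s) * a12
  have a20 : A 2 0 = 0 := by
    apply mul_right_cancel₀ hsin
    linear_combination (e02 - e12) / 2
  have a21 : A 2 1 = 0 := by
    apply mul_right_cancel₀ hsin
    linear_combination e22 - e02 + Real.sin (θ s) * a20
  have hΦ : Φ = -A 0 0 * Real.sin (θ s) := by
    linear_combination e00 + Real.cos (θ s) * a02
  have a11 : A 1 1 = A 0 0 := by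
    apply mul_right_cancel₀ hsin
    linear_combination e21 - hΦ + Real.cos (θ s) * a12
  refine ⟨?_, hΦ, ?_⟩
  · ext i j
    fin_cases i <;> fin_cases j <;> simp [a01, a02, a10, a11, a12, a20, a21]
  · linear_combination e02 - Real.sin (θ s) * a20

/-- Near a point with `θ' ≠ 0` there is an open set where `θ'`, `sin θ`, `cos θ` do not vanish. -/
theorem exists_open_generic (hC : IsProfileCurve I x z) (hθ : IsProfileAngle I x z θ)
    (hJ : {s : ℝ | s ∈ I ∧ deriv θ s ≠ 0}.Nonempty) :
    ∃ J ⊆ I, IsOpen J ∧ J.Nonempty ∧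
      ∀ s ∈ J, deriv θ s ≠ 0 ∧ Real.sin (θ s) ≠ 0 ∧ Real.cos (θ s) ≠ 0 := by
  obtain ⟨s₀, hs₀, h₀⟩ := hJ
  let f : ℝ → ℝ := fun s => deriv θ s * (Real.sin (θ s) * Real.cos (θ s))
  have hf : ContinuousOn f I := fun s hs =>
    have h := (hasDerivAt_angle hC hθ hs).continuousAt
    ((hasDerivAt_deriv_angle hC hθ hs).continuousAt.mul
      ((Real.continuous_sin.continuousAt.comp h).mul
      (Real.continuous_cos.continuousAt.comp h))).continuousWithinAt
  refine ⟨I ∩ f ⁻¹' {0}ᶜ, Set.inter_subset_left,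
    hf.isOpen_inter_preimage hC.isOpen isOpen_compl_singleton, ?_, ?_⟩
  -- `sin 2θ` detects zeros of `sin θ` and `cos θ` together. As `θ' ≠ 0` at `s₀`, it and its
  -- derivative cannot both vanish there, so it is nonzero at all nearby points other than `s₀`.
  · have hd : HasDerivAt (fun s => Real.sin (2 * θ s))
        (Real.cos (2 * θ s₀) * (2 * deriv θ s₀)) s₀ :=
      ((hasDerivAt_angle hC hθ hs₀).const_mul 2).sin
    have hsin : ∀ᶠ s in nhdsWithin s₀ {s₀}ᶜ, Real.sin (2 * θ s) ≠ 0 := by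
      by_cases h : Real.cos (2 * θ s₀) = 0
      · have h' : Real.sin (2 * θ s₀) ≠ 0 := fun h' => by
          have := Real.sin_sq_add_cos_sq (2 * θ s₀)
          simp [h, h'] at this
        exact (hd.continuousAt.eventually_ne h').filter_mono nhdsWithin_le_nhds
      · exact hd.eventually_ne (by simp [h, h₀])
    have hI := (hC.isOpen.eventually_mem hs₀).filter_mono
      (nhdsWithin_le_nhds (s := {s₀}ᶜ))
    have hθ' := ((hasDerivAt_deriv_angle hC hθ hs₀).continuousAt.eventually_ne h₀).filter_mono
      (nhdsWithin_le_nhds (s := {s₀}ᶜ))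
    obtain ⟨s, h₁, h₂, h₃⟩ := (hI.and (hθ'.and hsin)).exists
    refine ⟨s, h₁, ?_⟩
    rw [Real.sin_two_mul, mul_assoc] at h₃
    exact mul_ne_zero h₂ (right_ne_zero_of_mul h₃)
  · rintro s ⟨-, h⟩
    have h : f s ≠ 0 := h
    exact ⟨left_ne_zero_of_mul h, left_ne_zero_of_mul (right_ne_zero_of_mul h),
      right_ne_zero_of_mul (right_ne_zero_of_mul h)⟩

end ParamSurface

/-! ### Conclusion. -/

theorem lemma3p1 (I : Set ℝ) (x z θ : ℝ → ℝ)
    (hC : ParamSurface.IsProfileCurve I x z)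
    (hθ : ParamSurface.IsProfileAngle I x z θ)
    (hJ : {s : ℝ | s ∈ I ∧ deriv θ s ≠ 0}.Nonempty)
    (A : Matrix (Fin 3) (Fin 3) ℝ)
    (hA : ∀ s ∈ I, ∀ t : ℝ,
      ParamSurface.chengYauGauss (ParamSurface.revolution x z) (s, t)
        = A *ᵥ ParamSurface.gaussMap (ParamSurface.revolution x z) (s, t)) :
    ∃ c : ℝ, A = c • (1 : Matrix (Fin 3) (Fin 3) ℝ) := by
  obtain ⟨J, hJI, hJo, hne, hJ'⟩ := ParamSurface.exists_open_generic hC hθ hJ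
  have coeff := fun s (hs : s ∈ J) => ParamSurface.coefficients_of_chengYauGauss_eq hC hθ
    (hJI hs) (hJ' s hs).2.1 (hJ' s hs).2.2 (hA s (hJI hs))
  have hx : ∀ s ∈ J, x s ≠ 0 := fun s hs => (hC.x_pos s (hJI hs)).ne'
  have pyth : ∀ s, Real.sin (θ s) ^ 2 + Real.cos (θ s) ^ 2 = 1 := fun s =>
    Real.sin_sq_add_cos_sq _
  have h : A 0 0 = A 2 2 := by
    refine eq_of_principal_curvatures hJo hne
      (a := deriv θ) (b := fun s => Real.sin (θ s) / x s) (a' := deriv (deriv θ))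
      (b' := fun s => (Real.cos (θ s) * deriv θ s * x s - Real.sin (θ s) * Real.cos (θ s))
        / x s ^ 2)
      (fun s hs => ParamSurface.hasDerivAt_angle hC hθ (hJI hs))
      (fun s hs => ParamSurface.hasDerivAt_deriv_angle hC hθ (hJI hs))
      (fun s hs => (ParamSurface.hasDerivAt_angle hC hθ (hJI hs)).sin.div
        (ParamSurface.hasDerivAt_x hC hθ (hJI hs)) (hx s hs))
      (fun s hs => (hJ' s hs).1) (fun s hs => div_ne_zero (hJ' s hs).2.1 (hx s hs))
      (fun s hs => (hJ' s hs).2.1) (fun s hs => (hJ' s hs).2.2) ?_ ?_ ?_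
    · intro s hs
      have := hx s hs
      field_simp
    · intro s hs
      obtain ⟨-, h₁, h₂⟩ := coeff s hs
      have hx := hx s hs
      have e : deriv θ s * (Real.sin (θ s) / x s) * (deriv θ s + Real.sin (θ s) / x s)
          = deriv θ s ^ 2 * Real.sin (θ s) / x s + deriv θ s * Real.sin (θ s) ^ 2 / x s ^ 2 := by
        field_simp
      rw [e]
      -- Inner product with `G`, which is `(-sin θ, cos θ)` in radial and axial components.
      linear_combination Real.cos (θ s) * h₂ - Real.sin (θ s) * h₁
        - deriv θ s ^ 2 * Real.sin (θ s) / x s * pyth s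
    · intro s hs
      obtain ⟨-, h₁, h₂⟩ := coeff s hs
      have hx := hx s hs
      have e : deriv (deriv θ) s * (Real.sin (θ s) / x s) + deriv θ s *
          ((Real.cos (θ s) * deriv θ s * x s - Real.sin (θ s) * Real.cos (θ s)) / x s ^ 2)
          = deriv (deriv θ) s * Real.sin (θ s) / x s + deriv θ s ^ 2 * Real.cos (θ s) / x s
            - deriv θ s * Real.sin (θ s) * Real.cos (θ s) / x s ^ 2 := by
        field_simp
        ring
      simp only [e]
      -- Inner product with the meridian tangent `(cos θ, sin θ)`.
      linear_combination Real.cos (θ s) * h₁ + Real.sin (θ s) * h₂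
        - (deriv (deriv θ) s * Real.sin (θ s) + deriv θ s ^ 2 * Real.cos (θ s)) / x s * pyth s
  obtain ⟨s, hs⟩ := hne
  refine ⟨A 0 0, (coeff s hs).1.trans ?_⟩
  rw [← h]
  ext i j
  fin_cases i <;> fin_cases j <;> simp
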